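/- For $n\in\mathbb N=\{1,2,\dots\}$ let $M_n$ be the algebra of complex $n\times n$ matrices with the operator norm coming from the Euclidean space $\mathbb C^n$, let $\mathrm{U}(n)\subseteq M_n$ be the set of unitary matrices, let $\operatorname{tr}_n(X)=\frac1n\operatorname{Tr}(X)$, and identify $M_d\otimes M_k$ with $M_{dk}$ by the Kronecker product. Let $\delta_d\colon M_d\to M_d$, $\delta_d(X)=\operatorname{tr}_d(X)I_d$, be the completely depolarising channel, and for $C\in M_k$ let $S_C\colon M_k\to M_k$, $S_C(X)=(c_{i,j}x_{i,j})$, be Schur multiplication by $C$. Let $\mathrm{MU}(n)$ be the set of mixed unitary maps on $M_n$, i.e. the convex hull of the maps $X\mapsto UXU^*$ with $U\in \mathrm{U}(n)$. For a linear map $\Phi\colon M_n\to M_n$ let $\|\Phi\|$ be its operator norm, let $\|\Phi\|_{cb}=\sup_{m\in\mathbb N}\|\mathrm{id}_{M_m}\otimes\Phi\|$ be its completely bounded norm, and put \[\operatorname{dist}(\Phi,\mathrm{MU}(n))=\inf_{\Psi\in \mathrm{MU}(n)}\|\Phi-\Psi\|,\qquad \operatorname{dist}_{cb}(\Phi,\mathrm{MU}(n))=\inf_{\Psi\in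 \mathrm{MU}(n)}\|\Phi-\Psi\|_{cb}.\] Let $\mathcal F_k(d)=\{(\operatorname{tr}_d(U_i^*U_j))_{i,j=1}^k : U_1,\dots,U_k\in \mathrm{U}(d)\}$ and $\mathcal F_k=\overline{\bigcup_{d\in\mathbb N}\mathcal F_k(d)}\subseteq M_k$. Theorem. Let $C\in M_k$ be a correlation matrix, i.e. a positive semidefinite matrix all of whose diagonal entries equal $1$. The following are equivalent: (1) $C\in\mathcal F_k$; (2) $\inf_{d\in\mathbb N}\operatorname{dist}_{cb}(\delta_d\otimes S_C,\mathrm{MU}(dk))=0$; (3) $\inf_{d\in\mathbb N}\operatorname{dist}(\delta_d\otimes S_C,\mathrm{MU}(dk))=0$. -/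

import Mathlib

open scoped ENNReal ComplexOrder

noncomputable section

namespace SchurMU

/-- The complex square matrices with rows and columns indexed by `n`; the algebra `M_d` is
`Mat (Fin d)`, and `M_d ⊗ M_k` is realised as `Mat (Fin d × Fin k)` (Kronecker product). -/
abbrev Mat (n : Type) : Type := Matrix n n ℂ

/-- The normalised trace `tr_n(X) = Tr(X) / n`. -/
def normTrace {n : Type} [Fintype n] (X : Mat n) : ℂ :=
  (Fintype.card n : ℂ)⁻¹ * X.trace

/-- A correlation matrix: positive semidefinite with all diagonal entries equal to `1`. -/
def IsCorrelationMatrix {k : ℕ} (C : Mat (Fin k)) : Prop :=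
  C.PosSemidef ∧ ∀ i, C i i = 1

/-- `F_k(d)`: the `k × k` matrices `(tr_d(U_i^* U_j))` with `U_1, …, U_k` unitaries in `M_d`. -/
def unitaryMoments (k d : ℕ) : Set (Mat (Fin k)) :=
  {C | ∃ U : Fin k → Matrix.unitaryGroup (Fin d) ℂ,
    C = Matrix.of fun i j => normTrace (star (U i : Mat (Fin d)) * (U j : Mat (Fin d)))}

/-- `F_k`: the closure of the union of the sets `F_k(d)`, `d ≥ 1`. -/
def unitaryMomentsClosure (k : ℕ) : Set (Mat (Fin k)) :=
  closure (⋃ d : ℕ+, unitaryMoments k d)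

/-- The completely depolarising channel `X ↦ tr_d(X) I_d`. -/
def depolarising (n : Type) [Fintype n] [DecidableEq n] : Mat n →ₗ[ℂ] Mat n where
  toFun X := normTrace X • (1 : Mat n)
  map_add' X Y := by simp [normTrace, mul_add, add_smul]
  map_smul' c X := by simp [normTrace, smul_smul, mul_left_comm]

/-- The Schur multiplier `S_C : X ↦ C ∘ X` (entrywise product). -/
def schurMult {k : ℕ} (C : Mat (Fin k)) : Mat (Fin k) →ₗ[ℂ] Mat (Fin k) where
  toFun X := Matrix.hadamard C X
  map_add' X Y := Matrix.hadamard_add C X Y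
  map_smul' c X := Matrix.hadamard_smul C X c

/-- The tensor product `Φ ⊗ Ψ` of linear maps on matrix algebras, as a map on the Kronecker
product: it sends `A ⊗ B` to `Φ A ⊗ Ψ B`. -/
def tensorMap {m n : Type} [Fintype m] [DecidableEq m] [Fintype n] [DecidableEq n]
    (Φ : Mat m →ₗ[ℂ] Mat m) (Ψ : Mat n →ₗ[ℂ] Mat n) :
    Mat (m × n) →ₗ[ℂ] Mat (m × n) :=
  (kroneckerLinearEquiv m m n n ℂ).conj (TensorProduct.map Φ Ψ)

/-- The map `X ↦ U X U^*`. -/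
def conjMap {n : Type} [Fintype n] (U : Mat n) : Mat n →ₗ[ℂ] Mat n where
  toFun X := U * X * star U
  map_add' X Y := by simp [mul_add, add_mul]
  map_smul' c X := by simp

/-- The mixed unitary maps: the convex hull of the maps `X ↦ U X U^*` with `U` unitary. -/
def mixedUnitary (n : Type) [Fintype n] [DecidableEq n] : Set (Mat n →ₗ[ℂ] Mat n) :=
  convexHull ℝ (Set.range fun U : Matrix.unitaryGroup n ℂ => conjMap (U : Mat n))

section Norms

open scoped Matrix.Norms.L2Operator

/-- The norm of a linear map on `M_n`, where `M_n` carries the operator norm that comes from the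
Euclidean space `ℂ^n`. -/
def mapNorm {n : Type} [Fintype n] [DecidableEq n] (Φ : Mat n →ₗ[ℂ] Mat n) : ℝ≥0∞ :=
  ‖LinearMap.toContinuousLinearMap Φ‖ₑ

end Norms

/-- The completely bounded norm `sup_m ‖id_{M_m} ⊗ Φ‖`. -/
def cbNorm {n : Type} [Fintype n] [DecidableEq n] (Φ : Mat n →ₗ[ℂ] Mat n) : ℝ≥0∞ :=
  ⨆ m : ℕ, mapNorm (tensorMap (LinearMap.id : Mat (Fin m) →ₗ[ℂ] Mat (Fin m)) Φ)

/-- The distance to the mixed unitary maps in the norm of linear maps. -/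
def distMU {n : Type} [Fintype n] [DecidableEq n] (Φ : Mat n →ₗ[ℂ] Mat n) : ℝ≥0∞ :=
  ⨅ Ψ ∈ mixedUnitary n, mapNorm (Φ - Ψ)

/-- The distance to the mixed unitary maps in the completely bounded norm. -/
def distCbMU {n : Type} [Fintype n] [DecidableEq n] (Φ : Mat n →ₗ[ℂ] Mat n) : ℝ≥0∞ :=
  ⨅ Ψ ∈ mixedUnitary n, cbNorm (Φ - Ψ)

end SchurMU

end

open scoped ENNReal ComplexOrder

noncomputable section

namespace SchurMU

open scoped Kronecker Matrix
open Matrix (unitaryGroup)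

/-! ### Unitary part of a contraction -/

section Polar

variable {n : Type} [Fintype n]

/-! Write `D` for `δ_d ⊗ id`. It is mixed unitary, because averaging over the Weyl–Heisenberg
unitaries depolarises. If `C` is the moment matrix of `U_1, …, U_k` in `U(d)`, then `δ_d ⊗ S_C = D ∘
Ad W ∘ D` with `W` block diagonal with blocks `U_i^*`, so this map is exactly mixed unitary. A limit
of such `C` is handled by bounding the cb norm of `δ_d ⊗ S_C` by `∑ |c_ij|`, uniformly in `d`. This
gives (1) → (2), and (2) → (3) holds since the norm is at most the cb norm.

For (3) → (1), `blockTraces` is a linear map recovering `C` from `δ_d ⊗ S_C`, with entries bounded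
by the norm of the map, uniformly in `d`. On `Ad U` it gives `tr_d(A_i A_j^*)`, where the
contractions `A_i` are the diagonal blocks of `U`. When the diagonal of this matrix is close to `1`,
each `A_i` is close in Frobenius norm to a unitary, and replacing it by that unitary produces a
genuine moment matrix. In a mixture some of the unitaries may have large defect, so the error bound
is made affine in the defect (`nearMoments`). It then survives convex combinations, because the
closure of the moments is convex. -/

lemma inner_toLp_columns (M : Mat n) (i j : n) :
    inner ℂ (WithLp.toLp 2 fun a => M a i : EuclideanSpace ℂ n) (WithLp.toLp 2 fun a => M a j) =
      (Mᴴ * M) i j := by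
  simp [EuclideanSpace.inner_eq_star_dotProduct, Matrix.mul_apply, dotProduct, mul_comm]

/-- A matrix with orthogonal columns factors through a unitary. -/
lemma exists_unitary_of_orthogonal_columns [DecidableEq n] (M : Mat n) (l : n → ℝ) (hl : ∀ i, 0 ≤ l i)
    (hM : Mᴴ * M = Matrix.diagonal fun i => (l i : ℂ)) :
    ∃ B ∈ unitaryGroup n ℂ, ∀ i, (Bᴴ * M) i i = (√(l i) : ℂ) := by
  let v : n → EuclideanSpace ℂ n := fun j => WithLp.toLp 2 fun a => M a j
  have hv (i j) : inner ℂ (v i) (v j) = if i = j then (l i : ℂ) else 0 := by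
    rw [inner_toLp_columns, hM, Matrix.diagonal_apply]
  let f : n → EuclideanSpace ℂ n := fun j => ((√(l j))⁻¹ : ℂ) • v j
  have hf : Orthonormal ℂ ({j | l j ≠ 0}.domRestrict f) := by
    rw [orthonormal_iff_ite]
    rintro ⟨i, hi⟩ ⟨j, hj⟩
    simp only [Set.domRestrict_apply, f, inner_smul_left, inner_smul_right, hv, Subtype.mk.injEq]
    split_ifs with h
    · subst h
      have h0 : (√(l i) : ℂ) ≠ 0 := by
        exact_mod_cast (Real.sqrt_ne_zero (hl i)).2 hi
      have h1 : (l i : ℂ) = √(l i) * √(l i) := by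
        exact_mod_cast (Real.mul_self_sqrt (hl i)).symm
      simp only [map_inv₀, Complex.conj_ofReal]
      rw [h1]
      field_simp
    · simp
  -- Zero columns of `M` impose no condition: the extension fills their places with arbitrary basis
  -- vectors.
  obtain ⟨b, hb⟩ := hf.exists_orthonormalBasis_extension_of_card_eq (by simp)
  have hvb (i) : v i = (√(l i) : ℂ) • b i := by
    by_cases h : l i = 0
    · have : inner ℂ (v i) (v i) = (0 : ℂ) := by rw [hv, if_pos rfl, h, Complex.ofReal_zero]
      rw [inner_self_eq_zero] at this
      simp [this, h]
    · have h0 : (√(l i) : ℂ) ≠ 0 := by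
        exact_mod_cast (Real.sqrt_ne_zero (hl i)).2 h
      rw [hb i h, smul_smul, mul_inv_cancel₀ h0, one_smul]
  let B : Mat n := Matrix.of fun a j => b j a
  have hB : ∀ i j, (Bᴴ * B) i j = if i = j then 1 else 0 := fun i j => by
    rw [← inner_toLp_columns]
    exact orthonormal_iff_ite.1 b.orthonormal i j
  have hMB (a i) : M a i = √(l i) * B a i := congrArg (fun x : EuclideanSpace ℂ n => x a) (hvb i)
  refine ⟨B, Matrix.mem_unitaryGroup_iff'.2 ?_, fun i => ?_⟩
  · ext i j
    rw [Matrix.star_eq_conjTranspose, hB, Matrix.one_apply]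
  · have := hB i i
    simp only [Matrix.mul_apply, if_true] at this ⊢
    simp only [hMB, mul_left_comm, ← Finset.mul_sum, this, mul_one]

/-- Polar decomposition: if `W` diagonalises `A^*A`, the columns of `AW` are orthogonal, and the
unitary part `V` gives `Tr(V^*A) = ∑ √λ_i`. Since `0 ≤ λ_i ≤ 1`, this dominates `∑ λ_i = Tr(A^*A)`.
-/
lemma exists_unitary_trace_ge [DecidableEq n] (A : Mat n) (h : (1 - Aᴴ * A).PosSemidef) :
    ∃ V ∈ unitaryGroup n ℂ, (Aᴴ * A).trace.re ≤ (Vᴴ * A).trace.re := by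
  have hP : (Aᴴ * A).PosSemidef := Matrix.posSemidef_conjTranspose_mul_self A
  have hH := hP.isHermitian
  set W := hH.eigenvectorUnitary with hW
  have hWW : (W : Mat n) * (W : Mat n)ᴴ = 1 := Matrix.mem_unitaryGroup_iff.1 W.2
  have hd : (A * (W : Mat n))ᴴ * (A * (W : Mat n)) =
      Matrix.diagonal fun i => (hH.eigenvalues i : ℂ) := by
    have := hH.conjStarAlgAut_star_eigenvectorUnitary
    rw [Unitary.conjStarAlgAut_apply] at this
    rw [Matrix.conjTranspose_mul]
    simpa [Matrix.mul_assoc, Matrix.star_eq_conjTranspose, Function.comp_def] using this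
  have hle (i) : hH.eigenvalues i ≤ 1 := by
    have h1 := h.re_dotProduct_nonneg (hH.eigenvectorBasis i)
    have h2 := hH.eigenvalues_eq i
    have h3 : star (hH.eigenvectorBasis i : n → ℂ) ⬝ᵥ (hH.eigenvectorBasis i : n → ℂ) = 1 := by
      have := (orthonormal_iff_ite.1 hH.eigenvectorBasis.orthonormal) i i
      rw [EuclideanSpace.inner_eq_star_dotProduct] at this
      rw [dotProduct_comm]
      simpa using this
    rw [Matrix.sub_mulVec, dotProduct_sub, Matrix.one_mulVec, h3, map_sub, ← h2] at h1
    simpa using h1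
  obtain ⟨B, hB, hBM⟩ := exists_unitary_of_orthogonal_columns _ _ hP.eigenvalues_nonneg hd
  refine ⟨B * (W : Mat n)ᴴ, mul_mem hB (Unitary.star_mem W.2), ?_⟩
  have h1 : ((B * (W : Mat n)ᴴ)ᴴ * A).trace = ∑ i, (√(hH.eigenvalues i) : ℂ) := by
    rw [Matrix.conjTranspose_mul, Matrix.conjTranspose_conjTranspose, Matrix.mul_assoc,
      Matrix.trace_mul_comm, Matrix.mul_assoc]
    exact Finset.sum_congr rfl fun i _ => hBM i
  rw [h1, hH.trace_eq_sum_eigenvalues, Complex.re_sum, Complex.re_sum]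
  refine Finset.sum_le_sum fun i _ => ?_
  simp only [Complex.coe_algebraMap, Complex.ofReal_re]
  exact Real.le_sqrt_of_sq_le (by nlinarith [hle i, hP.eigenvalues_nonneg i])

/-- The squared Frobenius norm. -/
def frobSq (X : Mat n) : ℝ := ∑ a, ∑ b, ‖X a b‖ ^ 2

lemma frobSq_eq (X : Mat n) : frobSq X = (Xᴴ * X).trace.re := by
  simp only [frobSq, Matrix.trace, Matrix.diag, Matrix.mul_apply, Complex.re_sum]
  rw [Finset.sum_comm]
  refine Finset.sum_congr rfl fun b _ => Finset.sum_congr rfl fun a _ => ?_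
  rw [Matrix.conjTranspose_apply, Complex.star_def, ← Complex.normSq_eq_conj_mul_self,
    Complex.ofReal_re, Complex.normSq_eq_norm_sq]

lemma frobSq_unitary [DecidableEq n] {V : Mat n} (hV : V ∈ unitaryGroup n ℂ) : frobSq V = Fintype.card n := by
  rw [frobSq_eq, ← Matrix.star_eq_conjTranspose, Matrix.mem_unitaryGroup_iff'.1 hV,
    Matrix.trace_one, Complex.natCast_re]

lemma frobSq_sub (X Y : Mat n) :
    frobSq (X - Y) = frobSq X + frobSq Y - 2 * (Yᴴ * X).trace.re := by
  have h : (Xᴴ * Y).trace.re = (Yᴴ * X).trace.re := by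
    rw [← Complex.conj_re, ← Complex.star_def, ← Matrix.trace_conjTranspose,
      Matrix.conjTranspose_mul, Matrix.conjTranspose_conjTranspose]
  simp only [frobSq_eq, Matrix.conjTranspose_sub, Matrix.sub_mul, Matrix.mul_sub,
    Matrix.trace_sub, Complex.sub_re, h]
  ring

/-- A contraction is close to a unitary, in the Frobenius norm, as soon as its own Frobenius norm
is nearly maximal. -/
lemma exists_unitary_frobSq_sub_le [DecidableEq n] (A : Mat n) (h : (1 - Aᴴ * A).PosSemidef) :
    ∃ V ∈ unitaryGroup n ℂ, frobSq (A - V) ≤ Fintype.card n - frobSq A := by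
  obtain ⟨V, hV, hle⟩ := exists_unitary_trace_ge A h
  refine ⟨V, hV, ?_⟩
  rw [frobSq_sub, frobSq_unitary hV]
  rw [← frobSq_eq] at hle
  linarith

/-- Weighted AM–GM in place of Cauchy–Schwarz: the bound is linear in the squared norms, as
averaging over mixed unitaries later requires. -/
lemma norm_trace_mul_conjTranspose_le (X Y : Mat n) {s : ℝ} (hs : 0 < s) :
    ‖(X * Yᴴ).trace‖ ≤ (frobSq X / s + s * frobSq Y) / 2 := by
  have key (x y : ℂ) : ‖x * star y‖ ≤ (‖x‖ ^ 2 / s + s * ‖y‖ ^ 2) / 2 := by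
    rw [norm_mul, norm_star, le_div_iff₀ two_pos, div_add' _ _ _ hs.ne', le_div_iff₀ hs]
    nlinarith [sq_nonneg (‖x‖ - s * ‖y‖)]
  calc ‖(X * Yᴴ).trace‖ ≤ ∑ a, ∑ b, ‖X a b * star (Y a b)‖ := by
        simp only [Matrix.trace, Matrix.diag, Matrix.mul_apply, Matrix.conjTranspose_apply]
        exact (norm_sum_le _ _).trans (Finset.sum_le_sum fun a _ => norm_sum_le _ _)
    _ ≤ ∑ a, ∑ b, (‖X a b‖ ^ 2 / s + s * ‖Y a b‖ ^ 2) / 2 :=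
        Finset.sum_le_sum fun a _ => Finset.sum_le_sum fun b _ => key _ _
    _ = _ := by
        simp only [frobSq, ← Finset.sum_div, Finset.sum_add_distrib, ← Finset.mul_sum]

end Polar

/-! ### Convexity of the closure of the unitary moments -/

section Moments

lemma convex_of_isClosed_of_midpoint {E : Type*} [AddCommGroup E] [Module ℝ E] [TopologicalSpace E]
    [ContinuousAdd E] [ContinuousSMul ℝ E] {S : Set E} (hS : IsClosed S)
    (hmid : ∀ x ∈ S, ∀ y ∈ S, (2⁻¹ : ℝ) • x + (2⁻¹ : ℝ) • y ∈ S) : Convex ℝ S := by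
  rw [convex_iff_forall_pos]
  intro x hx y hy a b ha hb hab
  let T : Set ℝ := {t | (1 - t) • x + t • y ∈ S}
  have hT : IsClosed T := hS.preimage (by fun_prop)
  have hT1 : (1 : ℝ) ∈ T := by simpa [T] using hy
  have hTmid {t u : ℝ} (ht : t ∈ T) (hu : u ∈ T) : (t + u) / 2 ∈ T := by
    have := hmid _ ht _ hu
    simp only [T, Set.mem_ofPred_eq] at this ⊢
    convert this using 1
    module
  have hsub : Set.Icc (0 : ℝ) 1 ⊆ T := by
    refine (hT.inter isClosed_Icc).Icc_subset_of_forall_exists_gt (by simpa [T] using hx) ?_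
    rintro t ⟨ht, ht0, ht1⟩ u (hu : t < u)
    -- Repeated midpoints with the endpoint `1` give points of `T` arbitrarily close to `t` from the
    -- right.
    have hseq (n : ℕ) : t + (1 - t) * (1 / 2) ^ n ∈ T := by
      induction n with
      | zero => simpa using hT1
      | succ n ih =>
        convert hTmid ht ih using 1
        ring
    obtain ⟨n, hn⟩ := exists_pow_lt_of_lt_one (sub_pos.2 hu) (y := (1 / 2 : ℝ)) (by norm_num)
    refine ⟨_, hseq n, ?_, ?_⟩
    · have : 0 < (1 - t) * (1 / 2 : ℝ) ^ n := mul_pos (by linarith) (by positivity)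
      linarith
    · have : 0 < (1 / 2 : ℝ) ^ n := by positivity
      nlinarith
  have := hsub ⟨hb.le, by linarith⟩
  simpa [T, ← hab] using this

variable {n : Type} [Fintype n] [DecidableEq n] {k : ℕ}

lemma unitaryMoments_of_fintype [Nonempty n] (U : Fin k → unitaryGroup n ℂ) :
    (Matrix.of fun i j => normTrace (star (U i : Mat n) * (U j : Mat n))) ∈
      ⋃ d : ℕ+, unitaryMoments k d := by
  obtain ⟨d, hd⟩ : ∃ d : ℕ+, Fintype.card n = d := ⟨⟨_, Fintype.card_pos⟩, rfl⟩
  let e : n ≃ Fin d := Fintype.equivFinOfCardEq hd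
  refine Set.mem_iUnion.2 ⟨d, ?_⟩
  refine ⟨fun i => ⟨(U i : Mat n).submatrix e.symm e.symm, ?_⟩, ?_⟩
  · rw [Matrix.mem_unitaryGroup_iff, Matrix.star_eq_conjTranspose, Matrix.conjTranspose_submatrix,
      Matrix.submatrix_mul_equiv, ← Matrix.star_eq_conjTranspose,
      Matrix.mem_unitaryGroup_iff.1 (U i).2, Matrix.submatrix_one_equiv]
  · ext i j
    simp only [Matrix.of_apply, normTrace, Matrix.star_eq_conjTranspose,
      Matrix.conjTranspose_submatrix, Matrix.submatrix_mul_equiv, hd, Fintype.card_fin]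
    congr 1
    exact (Equiv.sum_comp e.symm fun a => ((U i : Mat n)ᴴ * (U j : Mat n)) a a).symm

/-- The direct sum of `U_i ⊗ 1` and `1 ⊗ V_i` works: tensoring gives both summands the size `d * e`,
so the normalised trace weights them equally. -/
lemma midpoint_mem_iUnion_unitaryMoments {C D : Mat (Fin k)}
    (hC : C ∈ ⋃ d : ℕ+, unitaryMoments k d) (hD : D ∈ ⋃ d : ℕ+, unitaryMoments k d) :
    (2⁻¹ : ℝ) • C + (2⁻¹ : ℝ) • D ∈ ⋃ d : ℕ+, unitaryMoments k d := by
  obtain ⟨d, U, rfl⟩ := Set.mem_iUnion.1 hC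
  obtain ⟨e, V, rfl⟩ := Set.mem_iUnion.1 hD
  let W : Fin k → Mat ((Fin d × Fin e) ⊕ (Fin d × Fin e)) := fun i =>
    Matrix.fromBlocks ((U i : Mat (Fin d)) ⊗ₖ (1 : Mat (Fin e))) 0 0
      ((1 : Mat (Fin d)) ⊗ₖ (V i : Mat (Fin e)))
  have hWW (i j) : star (W i) * W j =
      Matrix.fromBlocks ((star (U i : Mat (Fin d)) * (U j : Mat (Fin d))) ⊗ₖ (1 : Mat (Fin e))) 0 0
        ((1 : Mat (Fin d)) ⊗ₖ (star (V i : Mat (Fin e)) * (V j : Mat (Fin e)))) := by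
    simp [W, Matrix.star_eq_conjTranspose, Matrix.fromBlocks_conjTranspose,
      Matrix.fromBlocks_multiply, Matrix.conjTranspose_kronecker, ← Matrix.mul_kronecker_mul]
  have hW (i) : W i ∈ unitaryGroup _ ℂ := by
    rw [Matrix.mem_unitaryGroup_iff', hWW, Matrix.mem_unitaryGroup_iff'.1 (U i).2,
      Matrix.mem_unitaryGroup_iff'.1 (V i).2, Matrix.one_kronecker_one, Matrix.fromBlocks_one]
  convert unitaryMoments_of_fintype fun i => (⟨W i, hW i⟩ : unitaryGroup _ ℂ) using 1
  ext i j
  have hdiag (A B : Mat (Fin d × Fin e)) :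
      (Matrix.fromBlocks A 0 0 B).trace = A.trace + B.trace := by
    simp [Matrix.trace, Fintype.sum_sum_type]
  have hd : ((d : ℕ) : ℂ) ≠ 0 := by exact_mod_cast d.ne_zero
  have he : ((e : ℕ) : ℂ) ≠ 0 := by exact_mod_cast e.ne_zero
  simp only [Matrix.add_apply, Matrix.smul_apply, Matrix.of_apply, hWW, normTrace,
    hdiag, Matrix.trace_kronecker, Matrix.trace_one, Fintype.card_sum,
    Fintype.card_prod, Fintype.card_fin, Complex.real_smul]
  push_cast
  field_simp
  ring

lemma convex_unitaryMomentsClosure (k : ℕ) : Convex ℝ (unitaryMomentsClosure k) :=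
  convex_of_isClosed_of_midpoint isClosed_closure fun _ hx _ hy =>
    map_mem_closure₂ (f := fun A B => (2⁻¹ : ℝ) • A + (2⁻¹ : ℝ) • B) (by fun_prop) hx hy fun _ ha _ hb =>
        midpoint_mem_iUnion_unitaryMoments ha hb

end Moments

/-! ### Tensor products of maps -/

section Tensor

variable {m n : Type} [Fintype m] [DecidableEq m] [Fintype n] [DecidableEq n]

lemma tensorMap_kronecker (Φ : Mat m →ₗ[ℂ] Mat m) (Ψ : Mat n →ₗ[ℂ] Mat n) (A : Mat m)
    (B : Mat n) : tensorMap Φ Ψ (A ⊗ₖ B) = Φ A ⊗ₖ Ψ B := by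
  simp [tensorMap, LinearEquiv.conj_apply]

lemma linearMap_ext_kronecker {E : Type*} [AddCommMonoid E] [Module ℂ E]
    {Φ Ψ : Mat (m × n) →ₗ[ℂ] E} (h : ∀ (A : Mat m) (B : Mat n), Φ (A ⊗ₖ B) = Ψ (A ⊗ₖ B)) :
    Φ = Ψ := by
  rw [← LinearEquiv.eq_comp_toLinearMap_iff (e₁₂ := kroneckerLinearEquiv m m n n ℂ)]
  exact TensorProduct.ext' fun A B => by simpa using h A B

/-- The tensor product with a fixed right factor, as a linear map. -/
def tensorRight (m : Type) [Fintype m] [DecidableEq m] (Ψ : Mat n →ₗ[ℂ] Mat n) :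
    (Mat m →ₗ[ℂ] Mat m) →ₗ[ℂ] (Mat (m × n) →ₗ[ℂ] Mat (m × n)) where
  toFun Φ := tensorMap Φ Ψ
  map_add' Φ Φ' := linearMap_ext_kronecker fun A B => by
    simp [tensorMap_kronecker, Matrix.add_kronecker]
  map_smul' c Φ := linearMap_ext_kronecker fun A B => by
    simp [tensorMap_kronecker, Matrix.smul_kronecker]

/-- The tensor product with a fixed left factor, as a linear map. -/
def tensorLeft (n : Type) [Fintype n] [DecidableEq n] (Φ : Mat m →ₗ[ℂ] Mat m) :
    (Mat n →ₗ[ℂ] Mat n) →ₗ[ℂ] (Mat (m × n) →ₗ[ℂ] Mat (m × n)) where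
  toFun Ψ := tensorMap Φ Ψ
  map_add' Ψ Ψ' := linearMap_ext_kronecker fun A B => by
    simp [tensorMap_kronecker, Matrix.kronecker_add]
  map_smul' c Ψ := linearMap_ext_kronecker fun A B => by
    simp [tensorMap_kronecker, Matrix.kronecker_smul]

lemma tensorMap_sub_right (Φ : Mat m →ₗ[ℂ] Mat m) (Ψ Ψ' : Mat n →ₗ[ℂ] Mat n) :
    tensorMap Φ (Ψ - Ψ') = tensorMap Φ Ψ - tensorMap Φ Ψ' :=
  map_sub (tensorLeft n Φ) Ψ Ψ'

lemma tensorMap_conjMap_id (U : Mat m) :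
    tensorMap (conjMap U) (LinearMap.id : Mat n →ₗ[ℂ] Mat n) = conjMap (U ⊗ₖ (1 : Mat n)) :=
  linearMap_ext_kronecker fun A B => by
    simp [tensorMap_kronecker, conjMap, Matrix.star_eq_conjTranspose,
      Matrix.conjTranspose_kronecker, ← Matrix.mul_kronecker_mul]

lemma tensorMap_id_conjMap (U : Mat n) :
    tensorMap (LinearMap.id : Mat m →ₗ[ℂ] Mat m) (conjMap U) = conjMap ((1 : Mat m) ⊗ₖ U) :=
  linearMap_ext_kronecker fun A B => by
    simp [tensorMap_kronecker, conjMap, Matrix.star_eq_conjTranspose,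
      Matrix.conjTranspose_kronecker, ← Matrix.mul_kronecker_mul]

lemma kronecker_mem_unitaryGroup {U : Mat m} {V : Mat n} (hU : U ∈ unitaryGroup m ℂ)
    (hV : V ∈ unitaryGroup n ℂ) : U ⊗ₖ V ∈ unitaryGroup (m × n) ℂ :=
  Matrix.kronecker_mem_unitary hU hV

end Tensor

/-! ### Mixed unitary maps -/

section MixedUnitary

variable {m n : Type} [Fintype m] [DecidableEq m] [Fintype n] [DecidableEq n]

lemma conjMap_mem_mixedUnitary {U : Mat n} (hU : U ∈ unitaryGroup n ℂ) :
    conjMap U ∈ mixedUnitary n :=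
  subset_convexHull ℝ _ ⟨⟨U, hU⟩, rfl⟩

lemma convex_mixedUnitary : Convex ℝ (mixedUnitary n) := convex_convexHull ℝ _

/-- A real-linear map that sends unitary conjugations into a convex set sends all mixed unitary
maps into it. -/
lemma mixedUnitary_subset_preimage {E : Type*} [AddCommGroup E] [Module ℝ E]
    (f : (Mat n →ₗ[ℂ] Mat n) →ₗ[ℝ] E) {S : Set E} (hS : Convex ℝ S)
    (h : ∀ U ∈ unitaryGroup n ℂ, f (conjMap U) ∈ S) {Φ : Mat n →ₗ[ℂ] Mat n}
    (hΦ : Φ ∈ mixedUnitary n) : f Φ ∈ S := by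
  refine convexHull_min (t := f ⁻¹' S) ?_ (hS.linear_preimage f) hΦ
  rintro _ ⟨U, rfl⟩
  exact h U U.2

lemma conjMap_comp_conjMap {n : Type} [Fintype n] (U V : Mat n) : conjMap U ∘ₗ conjMap V = conjMap (U * V) := by
  ext1 X
  simp [conjMap, Matrix.mul_assoc]

lemma comp_mem_mixedUnitary {Φ Ψ : Mat n →ₗ[ℂ] Mat n} (hΦ : Φ ∈ mixedUnitary n)
    (hΨ : Ψ ∈ mixedUnitary n) : Φ ∘ₗ Ψ ∈ mixedUnitary n := by
  refine mixedUnitary_subset_preimage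
    (((LinearMap.lcomp ℂ (Mat n) Ψ).restrictScalars ℝ)) convex_mixedUnitary (fun U hU => ?_) hΦ
  refine mixedUnitary_subset_preimage
    (((LinearMap.llcomp ℂ (Mat n) (Mat n) (Mat n) (conjMap U)).restrictScalars ℝ))
    convex_mixedUnitary (fun V hV => ?_) hΨ
  change conjMap U ∘ₗ conjMap V ∈ _
  rw [conjMap_comp_conjMap]
  exact conjMap_mem_mixedUnitary (mul_mem hU hV)

lemma tensorMap_id_mem_mixedUnitary {Φ : Mat m →ₗ[ℂ] Mat m} (hΦ : Φ ∈ mixedUnitary m) :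
    tensorMap Φ (LinearMap.id : Mat n →ₗ[ℂ] Mat n) ∈ mixedUnitary (m × n) := by
  refine mixedUnitary_subset_preimage ((tensorRight m LinearMap.id).restrictScalars ℝ)
    convex_mixedUnitary (fun U hU => ?_) hΦ
  change tensorMap _ _ ∈ _
  rw [tensorMap_conjMap_id]
  exact conjMap_mem_mixedUnitary (kronecker_mem_unitaryGroup hU (one_mem _))

lemma id_tensorMap_mem_mixedUnitary {Φ : Mat n →ₗ[ℂ] Mat n} (hΦ : Φ ∈ mixedUnitary n) :
    tensorMap (LinearMap.id : Mat m →ₗ[ℂ] Mat m) Φ ∈ mixedUnitary (m × n) := by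
  refine mixedUnitary_subset_preimage ((tensorLeft n LinearMap.id).restrictScalars ℝ)
    convex_mixedUnitary (fun U hU => ?_) hΦ
  change tensorMap _ _ ∈ _
  rw [tensorMap_id_conjMap]
  exact conjMap_mem_mixedUnitary (kronecker_mem_unitaryGroup (one_mem _) hU)

open scoped Matrix.Norms.L2Operator in
lemma norm_apply_le_of_mem_mixedUnitary {Φ : Mat n →ₗ[ℂ] Mat n} (hΦ : Φ ∈ mixedUnitary n)
    (X : Mat n) : ‖Φ X‖ ≤ ‖X‖ := by
  have := mixedUnitary_subset_preimage ((LinearMap.applyₗ X).restrictScalars ℝ)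
    (convex_closedBall (0 : Mat n) ‖X‖) (fun U hU => ?_) hΦ
  · simpa using this
  · have h1 : ‖U * X * star U‖ = ‖X‖ := by
      rw [CStarRing.norm_mul_mem_unitary _ (Unitary.star_mem hU), CStarRing.norm_mem_unitary_mul _ hU]
    simpa [conjMap] using h1.le

end MixedUnitary

/-! ### The depolarising channel is mixed unitary -/

section Depolarising

/-- The Weyl–Heisenberg unitary that composes the shift by `c.1` with the character `c.2`. -/
def weyl {d : ℕ} [NeZero d] (c : ZMod d × ZMod d) : Mat (ZMod d) :=
  Matrix.of fun p q => if q = p + c.1 then ZMod.stdAddChar (c.2 * p) else 0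

variable {d : ℕ} [NeZero d]

lemma stdAddChar_mul_star (x y : ZMod d) :
    (ZMod.stdAddChar x : ℂ) * star (ZMod.stdAddChar y : ℂ) = ZMod.stdAddChar (x - y) := by
  rw [sub_eq_add_neg, AddChar.map_add_eq_mul, AddChar.map_neg_eq_conj, Complex.star_def]

lemma weyl_conj_apply (c : ZMod d × ZMod d) (X : Mat (ZMod d)) (p q : ZMod d) :
    conjMap (weyl c) X p q = ZMod.stdAddChar (c.2 * (p - q)) * X (p + c.1) (q + c.1) := by
  rw [mul_sub, ← stdAddChar_mul_star]
  simp only [conjMap, weyl, LinearMap.coe_mk, AddHom.coe_mk, Matrix.mul_apply, Matrix.of_apply,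
    Matrix.star_apply, ite_mul, zero_mul, Finset.sum_ite_eq', Finset.mem_univ, if_true,
    apply_ite star, star_zero, mul_ite, mul_zero]
  ring

lemma weyl_mem_unitaryGroup (c : ZMod d × ZMod d) : weyl c ∈ unitaryGroup (ZMod d) ℂ := by
  rw [Matrix.mem_unitaryGroup_iff]
  ext p q
  have := weyl_conj_apply c 1 p q
  simp only [conjMap, LinearMap.coe_mk, AddHom.coe_mk, mul_one] at this
  rw [this]
  by_cases h : p = q
  · subst h
    simp [Matrix.one_apply_eq]
  · simp [h]

/-- Averaging over characters kills the off-diagonal entries, and averaging over shifts replaces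
each diagonal entry by their mean. -/
lemma depolarising_eq_sum_weyl :
    depolarising (ZMod d) = ∑ c : ZMod d × ZMod d, ((d : ℝ) ^ 2)⁻¹ • conjMap (weyl c) := by
  ext1 X
  ext p q
  have hd : (d : ℂ) ≠ 0 := by exact_mod_cast NeZero.ne d
  simp only [← Finset.smul_sum, LinearMap.smul_apply, LinearMap.sum_apply, Matrix.smul_apply,
    Matrix.sum_apply, weyl_conj_apply, Fintype.sum_prod_type, ← Finset.sum_mul,
    AddChar.sum_mulShift _ (ZMod.isPrimitive_stdAddChar d), sub_eq_zero, ZMod.card]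
  simp only [depolarising, normTrace, LinearMap.coe_mk, AddHom.coe_mk, Matrix.smul_apply,
    Matrix.one_apply, smul_eq_mul, ZMod.card]
  by_cases h : p = q
  · subst h
    have : ∑ x, X (p + x) (p + x) = X.trace := Equiv.sum_comp (Equiv.addLeft p) fun a => X a a
    simp only [if_true, ← Finset.mul_sum, this, Complex.real_smul]
    push_cast
    field_simp
  · simp [h]

lemma depolarising_zmod_mem_mixedUnitary : depolarising (ZMod d) ∈ mixedUnitary (ZMod d) := by
  rw [depolarising_eq_sum_weyl]
  refine convex_mixedUnitary.sum_mem (fun _ _ => by positivity) ?_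
    fun c _ => conjMap_mem_mixedUnitary (weyl_mem_unitaryGroup c)
  have hd : (d : ℝ) ≠ 0 := by exact_mod_cast NeZero.ne d
  simp only [Finset.sum_const, Finset.card_univ, Fintype.card_prod, ZMod.card, nsmul_eq_mul]
  push_cast
  field_simp

/-- The completely depolarising channel is mixed unitary. -/
lemma depolarising_mem_mixedUnitary : depolarising (Fin d) ∈ mixedUnitary (Fin d) := by
  -- `ZMod (d + 1)` is `Fin (d + 1)` by definition, which becomes visible once `d` is a successor.
  obtain _ | d := d
  · exact absurd rfl (NeZero.ne 0)
  · exact depolarising_zmod_mem_mixedUnitary (d := d + 1)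

lemma depolarising_tensor_id_apply {d : ℕ} {n : Type} [Fintype n] [DecidableEq n]
    (X : Mat (Fin d × n)) (a b : Fin d) (i j : n) :
    tensorMap (depolarising (Fin d)) (LinearMap.id : Mat n →ₗ[ℂ] Mat n) X (a, i) (b, j) =
      if a = b then (d : ℂ)⁻¹ * ∑ c, X (c, i) (c, j) else 0 := by
  let f : Mat (Fin d × n) →ₗ[ℂ] ℂ :=
    { toFun X := if a = b then (d : ℂ)⁻¹ * ∑ c, X (c, i) (c, j) else 0
      map_add' X Y := by split_ifs <;> simp [Finset.sum_add_distrib, mul_add]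
      map_smul' r X := by split_ifs <;> simp [← Finset.mul_sum, mul_left_comm] }
  refine LinearMap.congr_fun (f := Matrix.entryLinearMap ℂ ℂ (a, i) (b, j) ∘ₗ tensorMap _ _)
    (g := f) (linearMap_ext_kronecker fun A B => ?_) X
  simp only [LinearMap.comp_apply, tensorMap_kronecker]
  simp [f, depolarising, normTrace, Matrix.trace, Matrix.one_apply, ← Finset.sum_mul, mul_assoc]

end Depolarising

/-! ### Norm estimates -/

section NormEstimates

open scoped Matrix.Norms.L2Operator

variable {n : Type} [Fintype n] [DecidableEq n]

lemma mapNorm_le_of_bound {Φ : Mat n →ₗ[ℂ] Mat n} {c : ℝ} (hc : 0 ≤ c)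
    (h : ∀ X, ‖Φ X‖ ≤ c * ‖X‖) : mapNorm Φ ≤ ENNReal.ofReal c := by
  rw [mapNorm, ← ofReal_norm]
  exact ENNReal.ofReal_le_ofReal (ContinuousLinearMap.opNorm_le_bound _ hc h)

lemma norm_apply_le_of_mapNorm_le {Φ : Mat n →ₗ[ℂ] Mat n} {c : ℝ} (hc : 0 ≤ c)
    (h : mapNorm Φ ≤ ENNReal.ofReal c) (X : Mat n) : ‖Φ X‖ ≤ c * ‖X‖ := by
  rw [mapNorm, ← ofReal_norm, ENNReal.ofReal_le_ofReal_iff hc] at h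
  exact (LinearMap.toContinuousLinearMap Φ).le_of_opNorm_le h X

lemma norm_one_kronecker (X : Mat n) : ‖(1 : Mat (Fin 1)) ⊗ₖ X‖ = ‖X‖ := by
  let e : n ≃ Fin 1 × n := (Equiv.uniqueProd n (Fin 1)).symm
  let φ : Mat n ≃⋆ₐ[ℂ] Mat (Fin 1 × n) :=
    .ofAlgEquiv (Matrix.reindexAlgEquiv ℂ ℂ e) fun X => by
      ext
      simp
  rw [← StarAlgEquiv.norm_map φ X]
  congr 1
  ext ⟨a, i⟩ ⟨b, j⟩
  simp [φ, e, Subsingleton.elim a b]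

lemma mapNorm_le_cbNorm (Φ : Mat n →ₗ[ℂ] Mat n) : mapNorm Φ ≤ cbNorm Φ := by
  refine le_iSup_of_le 1 ?_
  set Ψ := tensorMap (LinearMap.id : Mat (Fin 1) →ₗ[ℂ] Mat (Fin 1)) Φ with hΨ
  have hc : mapNorm Ψ = ENNReal.ofReal ‖LinearMap.toContinuousLinearMap Ψ‖ :=
    (ofReal_norm _).symm
  rw [hc]
  refine mapNorm_le_of_bound (norm_nonneg _) fun X => ?_
  have := norm_apply_le_of_mapNorm_le (norm_nonneg _) hc.le ((1 : Mat (Fin 1)) ⊗ₖ X)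
  rwa [hΨ, tensorMap_kronecker, LinearMap.id_apply, norm_one_kronecker, norm_one_kronecker] at this

lemma norm_diagonal_ite_le (p : n → Prop) [DecidablePred p] :
    ‖(Matrix.diagonal fun a => if p a then (1 : ℂ) else 0 : Mat n)‖ ≤ 1 := by
  rw [Matrix.l2_opNorm_diagonal, pi_norm_le_iff_of_nonneg zero_le_one]
  intro a
  split_ifs <;> simp

lemma norm_entry_le (X : Mat n) (p q : n) : ‖X p q‖ ≤ ‖X‖ := by
  have h1 := Matrix.l2_opNorm_mulVec X (EuclideanSpace.single q (1 : ℂ))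
  rw [PiLp.norm_single, norm_one, mul_one] at h1
  refine le_trans ?_ h1
  refine le_trans (le_of_eq ?_) (PiLp.norm_apply_le _ p)
  simp [Matrix.mulVec_single]

/-- By the C*-identity, since `N^*N` is a diagonal projection. -/
lemma norm_one_kronecker_single_le {m : Type} [Fintype m] [DecidableEq m] (i j : n) :
    ‖(1 : Mat m) ⊗ₖ (Matrix.single i j (1 : ℂ))‖ ≤ 1 := by
  set N : Mat (m × n) := (1 : Mat m) ⊗ₖ (Matrix.single i j (1 : ℂ)) with hN
  have h : Nᴴ * N = Matrix.diagonal fun p => if p.2 = j then (1 : ℂ) else 0 := by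
    rw [hN, Matrix.conjTranspose_kronecker, ← Matrix.mul_kronecker_mul]
    ext ⟨a, b⟩ ⟨a', b'⟩
    simp only [Matrix.conjTranspose_one, mul_one, Matrix.conjTranspose_single, star_one,
      Matrix.single_mul_single_same, Matrix.kronecker_apply, Matrix.one_apply,
      Matrix.single_apply, Matrix.diagonal_apply, Prod.mk.injEq]
    grind
  have h1 := Matrix.l2_opNorm_conjTranspose_mul_self N
  rw [h] at h1
  nlinarith [norm_diagonal_ite_le fun p : m × n => p.2 = j, norm_nonneg N]

end NormEstimates

/-! ### Moments give mixed unitary maps -/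

section Sufficiency

variable {d k : ℕ}

lemma depolarising_tensor_schurMult_eq (C : Mat (Fin k)) (X : Mat (Fin d × Fin k)) :
    tensorMap (depolarising (Fin d)) (schurMult C) X =
      Matrix.of fun p q => C p.2 q.2 *
        tensorMap (depolarising (Fin d)) (LinearMap.id : Mat (Fin k) →ₗ[ℂ] _) X p q := by
  let f : Mat (Fin d × Fin k) →ₗ[ℂ] Mat (Fin d × Fin k) :=
    { toFun X := Matrix.of fun p q => C p.2 q.2 * X p q
      map_add' X Y := by ext; simp [mul_add]
      map_smul' r X := by ext; simp [mul_left_comm] }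
  refine LinearMap.congr_fun (f := tensorMap _ _) (g := f ∘ₗ tensorMap _ _)
    (linearMap_ext_kronecker fun A B => ?_) X
  rw [LinearMap.comp_apply, tensorMap_kronecker, tensorMap_kronecker]
  ext
  simp [f, schurMult, mul_left_comm]

/-- The first `D` reduces the input to a multiple of `1 ⊗ B`. Conjugation by `W` turns block `(i,
j)` into `b_ij U_i^* U_j`, and the second `D` replaces that block by its normalised trace. -/
lemma depolarising_tensor_schurMult_mem_mixedUnitary [NeZero d] {C : Mat (Fin k)}
    (hC : C ∈ unitaryMoments k d) :
    tensorMap (depolarising (Fin d)) (schurMult C) ∈ mixedUnitary (Fin d × Fin k) := by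
  obtain ⟨U, rfl⟩ := hC
  set W : Mat (Fin d × Fin k) := Matrix.blockDiagonal fun i => star (U i : Mat (Fin d)) with hW
  have hWU : W ∈ unitaryGroup (Fin d × Fin k) ℂ := by
    rw [Matrix.mem_unitaryGroup_iff, Matrix.star_eq_conjTranspose, hW,
      Matrix.blockDiagonal_conjTranspose, ← Matrix.blockDiagonal_mul, ← Matrix.blockDiagonal_one]
    congr 1
    ext1 i
    rw [← Matrix.star_eq_conjTranspose, star_star, Matrix.mem_unitaryGroup_iff'.1 (U i).2]
    rfl
  set D : Mat (Fin d × Fin k) →ₗ[ℂ] Mat (Fin d × Fin k) :=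
    tensorMap (depolarising (Fin d)) LinearMap.id with hD
  have hDmem : D ∈ mixedUnitary _ := tensorMap_id_mem_mixedUnitary depolarising_mem_mixedUnitary
  suffices h : tensorMap (depolarising (Fin d)) (schurMult (Matrix.of fun i j =>
      normTrace (star (U i : Mat (Fin d)) * (U j : Mat (Fin d))))) = D ∘ₗ conjMap W ∘ₗ D by
    rw [h]
    exact comp_mem_mixedUnitary hDmem
      (comp_mem_mixedUnitary (conjMap_mem_mixedUnitary hWU) hDmem)
  refine linearMap_ext_kronecker fun A B => ?_
  have h1 : D (A ⊗ₖ B) = normTrace A • ((1 : Mat (Fin d)) ⊗ₖ B) := by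
    rw [hD, tensorMap_kronecker, ← Matrix.smul_kronecker]
    rfl
  have h2 (c : Fin d) (i j : Fin k) : conjMap W ((1 : Mat (Fin d)) ⊗ₖ B) (c, i) (c, j) =
      (star (U i : Mat (Fin d)) * (U j : Mat (Fin d))) c c * B i j := by
    simp [conjMap, hW, Matrix.mul_apply, Fintype.sum_prod_type, Matrix.blockDiagonal_apply,
      Matrix.one_apply, Matrix.star_apply, Finset.sum_mul, apply_ite (starRingEnd ℂ),
      mul_right_comm]
  rw [tensorMap_kronecker, LinearMap.comp_apply, LinearMap.comp_apply, h1, map_smul, map_smul]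
  ext ⟨a, i⟩ ⟨b, j⟩
  rw [Matrix.smul_apply, hD, depolarising_tensor_id_apply]
  simp only [h2, ← Finset.sum_mul]
  simp [depolarising, schurMult, normTrace, Matrix.trace, Matrix.one_apply, mul_assoc]

open scoped Matrix.Norms.L2Operator in
-- Schur multiplication by blocks is `∑ c_ij P_i (·) P_j` with diagonal projections `P_i`, applied
-- after the contraction `id ⊗ D`. The bound is crude, but what matters is that it depends on
-- neither `d` nor `m`.
lemma cbNorm_depolarising_tensor_schurMult_le [NeZero d] (C : Mat (Fin k)) :
    cbNorm (tensorMap (depolarising (Fin d)) (schurMult C)) ≤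
      ENNReal.ofReal (∑ i, ∑ j, ‖C i j‖) := by
  refine iSup_le fun m => mapNorm_le_of_bound
    (Finset.sum_nonneg fun i _ => Finset.sum_nonneg fun j _ => norm_nonneg _) fun X => ?_
  set I : Mat (Fin m) →ₗ[ℂ] Mat (Fin m) := LinearMap.id
  set D : Mat (Fin d × Fin k) →ₗ[ℂ] Mat (Fin d × Fin k) :=
    tensorMap (depolarising (Fin d)) LinearMap.id with hD
  let P (i : Fin k) : Mat (Fin m × Fin d × Fin k) :=
    Matrix.diagonal fun p => if p.2.2 = i then 1 else 0
  have hP (i) : ‖P i‖ ≤ 1 := norm_diagonal_ite_le fun p : Fin m × Fin d × Fin k => p.2.2 = i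
  have hDX : ‖tensorMap I D X‖ ≤ ‖X‖ := norm_apply_le_of_mem_mixedUnitary
    (id_tensorMap_mem_mixedUnitary
      (tensorMap_id_mem_mixedUnitary depolarising_mem_mixedUnitary)) X
  let f : Mat (Fin m × Fin d × Fin k) →ₗ[ℂ] Mat (Fin m × Fin d × Fin k) :=
    ∑ i, ∑ j, C i j • (LinearMap.mulLeft ℂ (P i) ∘ₗ LinearMap.mulRight ℂ (P j))
  have hf (Y) (p q) : f Y p q = C p.2.2 q.2.2 * Y p q := by
    simp [f, P, LinearMap.sum_apply, Matrix.sum_apply, Matrix.diagonal_mul, Matrix.mul_diagonal]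
  have key : tensorMap I (tensorMap (depolarising (Fin d)) (schurMult C)) =
      f ∘ₗ tensorMap I D := linearMap_ext_kronecker fun A B => by
    rw [LinearMap.comp_apply, tensorMap_kronecker, tensorMap_kronecker,
      depolarising_tensor_schurMult_eq]
    ext p q
    rw [hf]
    simp [mul_left_comm, hD]
  rw [key, LinearMap.comp_apply, Finset.sum_mul]
  simp only [f, LinearMap.sum_apply, LinearMap.smul_apply, LinearMap.comp_apply,
    LinearMap.mulLeft_apply, LinearMap.mulRight_apply, Finset.sum_mul]
  refine (norm_sum_le _ _).trans (Finset.sum_le_sum fun i _ =>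
    (norm_sum_le _ _).trans (Finset.sum_le_sum fun j _ => ?_))
  rw [norm_smul]
  refine mul_le_mul_of_nonneg_left ?_ (norm_nonneg _)
  calc ‖P i * (tensorMap I D X * P j)‖ ≤ ‖P i‖ * (‖tensorMap I D X‖ * ‖P j‖) :=
        (norm_mul_le _ _).trans (mul_le_mul_of_nonneg_left (norm_mul_le _ _) (norm_nonneg _))
    _ ≤ 1 * (‖X‖ * 1) := mul_le_mul (hP i) (mul_le_mul hDX (hP j) (norm_nonneg _) (norm_nonneg _))
        (mul_nonneg (norm_nonneg _) (norm_nonneg _)) zero_le_one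
    _ = ‖X‖ := by rw [one_mul, mul_one]

lemma sInf_distCbMU_eq_zero {C : Mat (Fin k)} (hC : C ∈ unitaryMomentsClosure k) :
    sInf (Set.range fun d : ℕ+ =>
      distCbMU (tensorMap (depolarising (Fin d)) (schurMult C))) = 0 := by
  rw [← nonpos_iff_eq_zero]
  refine ENNReal.le_of_forall_pos_le_add fun ε hε _ => ?_
  have hopen : IsOpen {B : Mat (Fin k) | ∑ i, ∑ j, ‖C i j - B i j‖ < ε} :=
    isOpen_lt (by fun_prop) continuous_const
  obtain ⟨B, hB, hBU⟩ := mem_closure_iff.1 hC _ hopen (by simpa using hε)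
  obtain ⟨d, hd⟩ := Set.mem_iUnion.1 hBU
  have : NeZero (d : ℕ) := ⟨d.ne_zero⟩
  rw [zero_add]
  refine (iInf_le _ d).trans ((iInf₂_le _ (depolarising_tensor_schurMult_mem_mixedUnitary hd)).trans ?_)
  rw [← tensorMap_sub_right]
  have hsub : schurMult C - schurMult B = schurMult (C - B) := by
    ext1 X
    ext
    simp [schurMult, sub_mul]
  rw [hsub]
  refine (cbNorm_depolarising_tensor_schurMult_le _).trans ?_
  exact ENNReal.ofReal_le_of_le_toReal (by simpa using hB.le)

end Sufficiency

/-! ### Nearby mixed unitary maps give moments -/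

section Necessity

variable {d k : ℕ}

/-- The matrix of normalised traces of the `(i, j)` blocks of `Φ (1 ⊗ e_{ij})`. -/
def blockTraces (d k : ℕ) : (Mat (Fin d × Fin k) →ₗ[ℂ] Mat (Fin d × Fin k)) →ₗ[ℂ] Mat (Fin k) where
  toFun Φ := Matrix.of fun i j =>
    (d : ℂ)⁻¹ * ∑ a, Φ ((1 : Mat (Fin d)) ⊗ₖ Matrix.single i j 1) (a, i) (a, j)
  map_add' Φ Ψ := by ext; simp [Finset.sum_add_distrib, mul_add]
  map_smul' c Φ := by ext; simp [← Finset.mul_sum, mul_left_comm]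

/-- Together with `norm_blockTraces_le`, this turns closeness of maps into entrywise closeness of `k
× k` matrices, uniformly in `d`. -/
lemma blockTraces_schurMult [NeZero d] (C : Mat (Fin k)) :
    blockTraces d k (tensorMap (depolarising (Fin d)) (schurMult C)) = C := by
  have hd : (d : ℂ) ≠ 0 := by exact_mod_cast NeZero.ne d
  ext i j
  simp [blockTraces, tensorMap_kronecker, depolarising, schurMult, normTrace, hd]

lemma norm_blockTraces_le [NeZero d] {Φ : Mat (Fin d × Fin k) →ₗ[ℂ] Mat (Fin d × Fin k)} {ε : ℝ}
    (hε : 0 ≤ ε) (h : mapNorm Φ ≤ ENNReal.ofReal ε) (i j : Fin k) :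
    ‖blockTraces d k Φ i j‖ ≤ ε := by
  open scoped Matrix.Norms.L2Operator in
  have hd : (d : ℝ) ≠ 0 := by exact_mod_cast NeZero.ne d
  have h1 : ‖Φ ((1 : Mat (Fin d)) ⊗ₖ Matrix.single i j 1)‖ ≤ ε :=
    (norm_apply_le_of_mapNorm_le hε h _).trans
      (mul_le_of_le_one_right hε (norm_one_kronecker_single_le i j))
  calc ‖blockTraces d k Φ i j‖ ≤ (d : ℝ)⁻¹ * ∑ _a : Fin d, ε := by
        simp only [blockTraces, LinearMap.coe_mk, AddHom.coe_mk, Matrix.of_apply, norm_mul,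
          norm_inv, Complex.norm_natCast]
        gcongr
        exact norm_sum_le_of_le _ fun a _ => (norm_entry_le _ _ _).trans h1
    _ = ε := by
        simp [hd]

/-- The `i`-th diagonal block of a matrix. -/
def diagBlock (U : Mat (Fin d × Fin k)) (i : Fin k) : Mat (Fin d) :=
  Matrix.of fun a b => U (a, i) (b, i)

lemma blockTraces_conjMap (U : Mat (Fin d × Fin k)) (i j : Fin k) :
    blockTraces d k (conjMap U) i j = (d : ℂ)⁻¹ * (diagBlock U i * (diagBlock U j)ᴴ).trace := by
  simp [blockTraces, conjMap, diagBlock, Matrix.trace, Matrix.mul_apply, Fintype.sum_prod_type,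
    Matrix.one_apply, Matrix.single_apply, ite_and, Finset.sum_ite_irrel]

lemma posSemidef_one_sub_diagBlock {U : Mat (Fin d × Fin k)}
    (hU : U ∈ unitaryGroup (Fin d × Fin k) ℂ) (i : Fin k) :
    (1 - (diagBlock U i)ᴴ * diagBlock U i).PosSemidef := by
  -- The rest of the `i`-th block column of `U`; the columns of `U` are orthonormal, so `A_i^*A_i +
  -- B^*B = 1`.
  let B : Matrix (Fin d × Fin k) (Fin d) ℂ :=
    Matrix.of fun p b => if p.2 = i then 0 else U p (b, i)
  have h : 1 - (diagBlock U i)ᴴ * diagBlock U i = Bᴴ * B := by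
    rw [sub_eq_iff_eq_add]
    ext a b
    have h1 := congrFun (congrFun (Matrix.mem_unitaryGroup_iff'.1 hU) (a, i)) (b, i)
    simp only [Matrix.mul_apply, Matrix.one_apply, Prod.mk.injEq, and_true, Matrix.add_apply,
      Matrix.conjTranspose_apply, Matrix.star_apply, Fintype.sum_prod_type, B, diagBlock,
      Matrix.of_apply] at h1 ⊢
    rw [← h1, ← Finset.sum_add_distrib]
    refine Finset.sum_congr rfl fun c _ => ?_
    rw [← Finset.add_sum_erase _ _ (Finset.mem_univ i),
      ← Finset.add_sum_erase (f := fun l => star (if l = i then 0 else U (c, l) (a, i)) * _) _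
        (Finset.mem_univ i), if_pos rfl, star_zero, zero_mul, zero_add, add_comm]
    congr 1
    refine Finset.sum_congr rfl fun l hl => ?_
    simp [Finset.ne_of_mem_erase hl]
  rw [h]
  exact Matrix.posSemidef_conjTranspose_mul_self B

/-- Matrices that are close to a convex combination of unitary moments, up to an error controlled
by the defect of the diagonal entries from `1`. -/
def nearMoments (k : ℕ) (s : ℝ) : Set (Mat (Fin k)) :=
  {T | ∃ G ∈ unitaryMomentsClosure k, ∀ i j,
    ‖T i j - G i j‖ ≤ ((1 - (T i i).re) + (1 - (T j j).re)) / (2 * s) + s}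

/-- The error bound is affine in the diagonal of `T`, so it mixes exactly as the matrices do. -/
lemma convex_nearMoments (k : ℕ) (s : ℝ) : Convex ℝ (nearMoments k s) := by
  rintro T ⟨G, hG, hT⟩ T' ⟨G', hG', hT'⟩ a b ha hb hab
  refine ⟨a • G + b • G', convex_unitaryMomentsClosure k hG hG' ha hb hab, fun i j => ?_⟩
  have h1 : (a • T + b • T') i j - (a • G + b • G') i j =
      a • (T i j - G i j) + b • (T' i j - G' i j) := by
    simp [smul_sub]
    ring
  rw [h1]
  refine (norm_add_le _ _).trans ?_
  rw [norm_smul, norm_smul, Real.norm_of_nonneg ha, Real.norm_of_nonneg hb]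
  refine (add_le_add (mul_le_mul_of_nonneg_left (hT i j) ha)
    (mul_le_mul_of_nonneg_left (hT' i j) hb)).trans (le_of_eq ?_)
  obtain rfl : b = 1 - a := by linarith
  simp
  ring

lemma blockTraces_conjMap_mem_nearMoments [NeZero d] {U : Mat (Fin d × Fin k)}
    (hU : U ∈ unitaryGroup (Fin d × Fin k) ℂ) {s : ℝ} (hs : 0 < s) :
    blockTraces d k (conjMap U) ∈ nearMoments k s := by
  have hd0 : 0 < (d : ℝ) := by exact_mod_cast NeZero.pos d
  choose V hV hVle using fun i =>
    exists_unitary_frobSq_sub_le _ (posSemidef_one_sub_diagBlock hU i)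
  simp only [Fintype.card_fin] at hVle
  set A := diagBlock U
  have hfrob (i) : frobSq (A i) ≤ d := by
    have : 0 ≤ frobSq (A i - V i) := by unfold frobSq; positivity
    linarith [hVle i]
  have hdef (i) : 1 - (blockTraces d k (conjMap U) i i).re = (d : ℝ)⁻¹ * (d - frobSq (A i)) := by
    rw [blockTraces_conjMap, Matrix.trace_mul_comm, frobSq_eq]
    rw [← Complex.ofReal_natCast, ← Complex.ofReal_inv, Complex.re_ofReal_mul, mul_sub,
      inv_mul_cancel₀ hd0.ne']
  refine ⟨Matrix.of fun i j => (d : ℂ)⁻¹ * (V i * (V j)ᴴ).trace, subset_closure ?_,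
    fun i j => ?_⟩
  · have : Nonempty (Fin d) := ⟨0⟩
    -- The products `V_i V_j^*` come in the opposite order to moments, hence the adjoints `V_i^*`.
    have := unitaryMoments_of_fintype fun i =>
      (⟨star (V i), Unitary.star_mem (hV i)⟩ : unitaryGroup (Fin d) ℂ)
    simpa [normTrace, Matrix.star_eq_conjTranspose] using this
  · rw [hdef, hdef, blockTraces_conjMap, Matrix.of_apply, ← mul_sub]
    have hsplit : (A i * (A j)ᴴ).trace - (V i * (V j)ᴴ).trace =
        ((A i - V i) * (A j)ᴴ).trace + (V i * (A j - V j)ᴴ).trace := by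
      simp only [Matrix.conjTranspose_sub, Matrix.sub_mul, Matrix.mul_sub, Matrix.trace_sub]
      ring
    -- The weights `s` and `s⁻¹` are chosen so that in both terms the small factor is divided by `s`
    -- and the factor of squared norm at most `d` is multiplied by `s`.
    have h1 := norm_trace_mul_conjTranspose_le (A i - V i) (A j) hs
    have h2 := norm_trace_mul_conjTranspose_le (V i) (A j - V j) (inv_pos.2 hs)
    rw [frobSq_unitary (hV i), Fintype.card_fin, div_inv_eq_mul] at h2
    rw [norm_mul, norm_inv, Complex.norm_natCast, hsplit]
    have h3 : frobSq (A i - V i) / s ≤ (d - frobSq (A i)) / s := by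
      gcongr
      exact hVle i
    have h4 : s⁻¹ * frobSq (A j - V j) ≤ s⁻¹ * (d - frobSq (A j)) := by
      gcongr
      exact hVle j
    have h5 : s * frobSq (A j) ≤ s * d := by
      gcongr
      exact hfrob j
    have h6 : ‖((A i - V i) * (A j)ᴴ).trace + (V i * (A j - V j)ᴴ).trace‖ ≤
        ((d - frobSq (A i)) / s + s * d) / 2 + (d * s + s⁻¹ * (d - frobSq (A j))) / 2 := by
      refine (norm_add_le _ _).trans ?_
      linarith
    refine (mul_le_mul_of_nonneg_left h6 (inv_nonneg.2 hd0.le)).trans (le_of_eq ?_)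
    field_simp
    ring

lemma blockTraces_mem_nearMoments [NeZero d]
    {Ψ : Mat (Fin d × Fin k) →ₗ[ℂ] Mat (Fin d × Fin k)} (hΨ : Ψ ∈ mixedUnitary (Fin d × Fin k))
    {s : ℝ} (hs : 0 < s) : blockTraces d k Ψ ∈ nearMoments k s :=
  mixedUnitary_subset_preimage ((blockTraces d k).restrictScalars ℝ) (convex_nearMoments k s)
    (fun _ hU => blockTraces_conjMap_mem_nearMoments hU hs) hΨ

lemma exists_moments_near {C : Mat (Fin k)} (hdiag : ∀ i, C i i = 1)
    (h : sInf (Set.range fun d : ℕ+ =>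
      distMU (tensorMap (depolarising (Fin d)) (schurMult C))) = 0) {s : ℝ} (hs : 0 < s) :
    ∃ G ∈ unitaryMomentsClosure k, ∀ i j, ‖G i j - C i j‖ ≤ s ^ 2 + 2 * s := by
  have hs2 : 0 < s ^ 2 := by positivity
  -- Distance below `s ^ 2` makes each diagonal defect at most `s ^ 2`, so the `nearMoments` error
  -- is at most `s ^ 2 / s + s = 2 * s`.
  have hlt : sInf (Set.range fun d : ℕ+ =>
      distMU (tensorMap (depolarising (Fin d)) (schurMult C))) < ENNReal.ofReal (s ^ 2) := by
    rw [h]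
    exact ENNReal.ofReal_pos.2 hs2
  obtain ⟨_, ⟨d, rfl⟩, hlt⟩ := sInf_lt_iff.1 hlt
  simp only [distMU, iInf_lt_iff] at hlt
  obtain ⟨Ψ, hΨ, hlt⟩ := hlt
  have : NeZero (d : ℕ) := ⟨d.ne_zero⟩
  obtain ⟨G, hG, hGle⟩ := blockTraces_mem_nearMoments hΨ hs
  have hnear (i j) : ‖C i j - blockTraces d k Ψ i j‖ ≤ s ^ 2 := by
    have := norm_blockTraces_le hs2.le hlt.le i j
    rwa [map_sub, blockTraces_schurMult, Matrix.sub_apply] at this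
  have hdefect (i) : 1 - (blockTraces d k Ψ i i).re ≤ s ^ 2 := by
    have := (Complex.re_le_norm _).trans (hnear i i)
    rwa [hdiag, Complex.sub_re, Complex.one_re] at this
  refine ⟨G, hG, fun i j => ?_⟩
  have h1 : ((1 - (blockTraces d k Ψ i i).re) + (1 - (blockTraces d k Ψ j j).re)) / (2 * s) ≤ s := by
    rw [div_le_iff₀ (by positivity)]
    nlinarith [hdefect i, hdefect j]
  calc ‖G i j - C i j‖ ≤ ‖C i j - blockTraces d k Ψ i j‖ + ‖blockTraces d k Ψ i j - G i j‖ := by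
        rw [norm_sub_rev]
        exact norm_sub_le_norm_sub_add_norm_sub _ _ _
    _ ≤ s ^ 2 + 2 * s := by linarith [hnear i j, hGle i j]

lemma mem_unitaryMomentsClosure_of_sInf_distMU {C : Mat (Fin k)} (hdiag : ∀ i, C i i = 1)
    (h : sInf (Set.range fun d : ℕ+ =>
      distMU (tensorMap (depolarising (Fin d)) (schurMult C))) = 0) :
    C ∈ unitaryMomentsClosure k := by
  choose G hG hGle using fun n : ℕ =>
    exists_moments_near hdiag h (s := 1 / ((n : ℝ) + 1)) Nat.one_div_pos_of_nat
  refine isClosed_closure.mem_of_tendsto (f := G) (b := Filter.atTop) ?_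
    (Filter.Eventually.of_forall hG)
  refine tendsto_pi_nhds.2 fun i => tendsto_pi_nhds.2 fun j => ?_
  rw [tendsto_iff_norm_sub_tendsto_zero]
  refine squeeze_zero (fun _ => norm_nonneg _) (fun n => hGle n i j) ?_
  have := tendsto_one_div_add_atTop_nhds_zero_nat (𝕜 := ℝ)
  simpa using (this.pow 2).add (this.const_mul 2)

end Necessity

end SchurMU

end

theorem theorem3p6 (k : ℕ) (C : SchurMU.Mat (Fin k)) (hC : SchurMU.IsCorrelationMatrix C) :
    List.TFAE
      [ C ∈ SchurMU.unitaryMomentsClosure k,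
        sInf (Set.range fun d : ℕ+ => SchurMU.distCbMU
          (SchurMU.tensorMap (SchurMU.depolarising (Fin d)) (SchurMU.schurMult C))) = 0,
        sInf (Set.range fun d : ℕ+ => SchurMU.distMU
          (SchurMU.tensorMap (SchurMU.depolarising (Fin d)) (SchurMU.schurMult C))) = 0 ] := by
  tfae_have 1 → 2 := SchurMU.sInf_distCbMU_eq_zero
  tfae_have 2 → 3 := fun h => by
    rw [← nonpos_iff_eq_zero, ← h]
    exact iInf_mono fun d => iInf₂_mono fun Ψ _ => SchurMU.mapNorm_le_cbNorm _
  tfae_have 3 → 1 := SchurMU.mem_unitaryMomentsClosure_of_sInf_distMU hC.2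
  tfae_finish
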